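/- Let $\mathcal{M}an$ be the category of smooth manifolds (finite-dimensional, without boundary, Hausdorff, second countable) and smooth maps. For a manifold $M$ let $C_\bullet(M)$ be the complex of smooth singular chains: $C_n(M)$ is the free abelian group on the smooth singular simplices $\Delta^n\to M$ (maps that extend smoothly to an open neighbourhood of $\Delta^n$ in $\mathbb{R}^{n+1}$), with the usual boundary operator. Let $C^\bullet(M)=\mathrm{Hom}(C_\bullet(M),\mathbb{Z})$ be the dual complex of smooth singular cochains, which is a presheaf of complexes on $\mathcal{M}an$. Let $\mathcal{H}^1(C^\bullet)$ be the presheaf of groupoids on $\mathcal{M}an$ defined as follows: the objects of $\mathcal{H}^1(C^\bullet)(M)$ are the cocycles $z\in C^1(M)$, $dz=0$; the morphisms $z\to z'$ are the cochains $b\in C^0(M)$ with $db=z'-z$; composition is addition; and restriction along a smooth map is the pull-back of cochains. **Proposition (Mayer–Vietoris).** The presheaf of groupoids $\mathcal{H}^1(C^\bullet)$ is a stack on $\mathcal{M}an$ for the Grothendieck topology of open coverings. In particular, its descent data is effective for every covering: for every covering of a manifold $M$ by open subsets $\{U_\alpha\}$, and for every surjective submersion $U\to M$ from a manifold $U$,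 the restriction functor from $\mathcal{H}^1(C^\bullet)(M)$ to the groupoid of descent data of $\mathcal{H}^1(C^\bullet)$ with respect to that covering is an equivalence of categories. -/

import Mathlib

open CategoryTheory Opposite Simplicial
open scoped Manifold ContDiff

universe u v w

noncomputable section

/-! ### The category of smooth manifolds -/

/-- A smooth manifold: finite-dimensional, without boundary, Hausdorff and second countable. -/
structure SmoothMan : Type (u + 1) where
  carrier : Type u
  dim : ℕ
  [top : TopologicalSpace carrier]
  [charted : ChartedSpace (EuclideanSpace ℝ (Fin dim)) carrier]
  [isManifold : IsManifold (𝓡 dim) ∞ carrier]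
  [t2 : T2Space carrier]
  [secondCountable : SecondCountableTopology carrier]

namespace SmoothMan

instance : CoeSort SmoothMan.{u} (Type u) := ⟨SmoothMan.carrier⟩

attribute [instance] top charted isManifold t2 secondCountable

/-- Smooth maps between manifolds. -/
@[ext]
structure Hom (M N : SmoothMan.{u}) : Type u where
  toFun : M → N
  contMDiff : ContMDiff (𝓡 M.dim) (𝓡 N.dim) ∞ toFun

instance : Category SmoothMan.{u} where
  Hom := Hom
  id M := ⟨id, contMDiff_id⟩
  comp f g := ⟨g.toFun ∘ f.toFun, g.contMDiff.comp f.contMDiff⟩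

@[simp] lemma id_toFun (M : SmoothMan.{u}) : Hom.toFun (𝟙 M) = id := rfl

@[simp] lemma comp_toFun {M N P : SmoothMan.{u}} (f : M ⟶ N) (g : N ⟶ P) :
    (f ≫ g).toFun = g.toFun ∘ f.toFun := rfl

@[ext] lemma hom_ext {M N : SmoothMan.{u}} {f g : M ⟶ N} (h : f.toFun = g.toFun) : f = g :=
  Hom.ext h

/-- An open subset of a manifold, as a manifold. -/
def ofOpen (M : SmoothMan.{u}) (U : TopologicalSpace.Opens M) : SmoothMan.{u} where
  carrier := U
  dim := M.dim

/-- The inclusion of an open subset. -/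
def incl (M : SmoothMan.{u}) (U : TopologicalSpace.Opens M) : M.ofOpen U ⟶ M where
  toFun := Subtype.val
  contMDiff := contMDiff_subtype_val (M := M) (I := 𝓡 M.dim) (U := U)

/-- The lift of a smooth map to an open subset that contains its image. -/
def lift {M N : SmoothMan.{u}} (f : N ⟶ M) (U : TopologicalSpace.Opens M)
    (h : ∀ x, f.toFun x ∈ U) : N ⟶ M.ofOpen U where
  toFun x := ⟨f.toFun x, h x⟩
  contMDiff := (ContMDiff.subtypeVal_comp_iff (I := 𝓡 N.dim) (I' := 𝓡 M.dim) U
    (fun x ↦ (⟨f.toFun x, h x⟩ : U))).1 f.contMDiff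

lemma lift_incl {M N : SmoothMan.{u}} (f : N ⟶ M) (U : TopologicalSpace.Opens M)
    (h : ∀ x, f.toFun x ∈ U) : lift f U h ≫ M.incl U = f := rfl

lemma continuous_toFun {M N : SmoothMan.{u}} (f : N ⟶ M) : Continuous f.toFun :=
  f.contMDiff.continuous

/-- The Grothendieck topology of open coverings: a sieve on `M` is covering if and only if it
contains the inclusions of all members of some covering of `M` by open subsets. -/
def openTopology : GrothendieckTopology SmoothMan.{u} where
  sieves M := {R | ∀ x : M, ∃ U : TopologicalSpace.Opens M, x ∈ U ∧ R (M.incl U)}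
  top_mem' _ _ := ⟨⊤, trivial, trivial⟩
  pullback_stable' M N R f hR x := by
    obtain ⟨U, hxU, hU⟩ := hR (f.toFun x)
    refine ⟨U.comap ⟨f.toFun, continuous_toFun f⟩, hxU, ?_⟩
    exact R.downward_closed hU (lift (N.incl _ ≫ f) U (fun y ↦ y.2) :
      N.ofOpen (U.comap ⟨f.toFun, continuous_toFun f⟩) ⟶ M.ofOpen U)
  transitive' M R hR S hS x := by
    obtain ⟨U, hxU, hU⟩ := hR x
    obtain ⟨V, hxV, hV⟩ := hS hU ⟨x, hxU⟩
    let W : TopologicalSpace.Opens M :=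
      ⟨(M.incl U).toFun '' V.carrier, U.isOpen.isOpenMap_subtype_val _ V.is_open'⟩
    have hWU : ∀ y : M.ofOpen W, (M.incl W).toFun y ∈ U := by
      rintro ⟨_, ⟨y, _, rfl⟩⟩
      exact y.2
    have hWV : ∀ y : M.ofOpen W, (lift (M.incl W) U hWU).toFun y ∈ V := by
      rintro ⟨_, ⟨y, hy, rfl⟩⟩
      exact hy
    refine ⟨W, ⟨⟨x, hxU⟩, hxV, rfl⟩, ?_⟩
    exact S.downward_closed hV (lift (lift (M.incl W) U hWU) V hWV)

end SmoothMan

/-! ### Smooth singular simplices and cochains -/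

/-- A smooth singular `n`-simplex: a map from the standard simplex to `M` that extends to a
smooth map on an open neighbourhood of the standard simplex in `ℝ^(n+1)`. -/
@[ext]
structure SmoothSimplex (n : ℕ) (M : SmoothMan.{u}) : Type u where
  toFun : stdSimplex ℝ (Fin (n + 1)) → M
  exists_extension : ∃ (V : Set (Fin (n + 1) → ℝ)) (g : (Fin (n + 1) → ℝ) → M),
    IsOpen V ∧ stdSimplex ℝ (Fin (n + 1)) ⊆ V ∧
    ContMDiffOn 𝓘(ℝ, Fin (n + 1) → ℝ) (𝓡 M.dim) ∞ g V ∧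
    ∀ x : stdSimplex ℝ (Fin (n + 1)), g x = toFun x

namespace SmoothSimplex

variable {n m : ℕ} {M N : SmoothMan.{u}}

/-- The image of a smooth simplex under a smooth map. -/
def push (f : M ⟶ N) (σ : SmoothSimplex n M) : SmoothSimplex n N where
  toFun x := f.toFun (σ.toFun x)
  exists_extension := by
    obtain ⟨V, g, hV, hsub, hg, hext⟩ := σ.exists_extension
    exact ⟨V, f.toFun ∘ g, hV, hsub, f.contMDiff.comp_contMDiffOn hg,
      fun x ↦ congrArg f.toFun (hext x)⟩

/-- Precomposition with the affine map of standard simplices given by `φ` on the vertices. -/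
def pull (φ : Fin (m + 1) → Fin (n + 1)) (σ : SmoothSimplex n M) : SmoothSimplex m M where
  toFun x := σ.toFun (stdSimplex.map φ x)
  exists_extension := by
    obtain ⟨V, g, hV, hsub, hg, hext⟩ := σ.exists_extension
    let L : (Fin (m + 1) → ℝ) →L[ℝ] (Fin (n + 1) → ℝ) :=
      LinearMap.toContinuousLinearMap (FunOnFinite.linearMap ℝ ℝ φ)
    refine ⟨L ⁻¹' V, g ∘ L, hV.preimage L.continuous, fun x hx ↦ ?_, ?_, fun x ↦ ?_⟩
    · exact hsub (stdSimplex.map φ ⟨x, hx⟩).2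
    · exact hg.comp L.contMDiff.contMDiffOn (fun x hx ↦ hx)
    · exact hext (stdSimplex.map φ x)

lemma pull_id (σ : SmoothSimplex n M) : pull id σ = σ :=
  SmoothSimplex.ext (funext fun x ↦ congrArg σ.toFun (stdSimplex.map_id_apply x))

lemma pull_comp {k : ℕ} (φ : Fin (m + 1) → Fin (n + 1)) (ψ : Fin (k + 1) → Fin (m + 1))
    (σ : SmoothSimplex n M) : pull (φ ∘ ψ) σ = pull ψ (pull φ σ) :=
  SmoothSimplex.ext (funext fun x ↦ congrArg σ.toFun (stdSimplex.map_comp_apply ψ φ x).symm)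

end SmoothSimplex

/-- The simplicial set of smooth singular simplices of a manifold. -/
def smoothSing (M : SmoothMan.{u}) : SSet.{u} where
  obj n := SmoothSimplex n.unop.len M
  map φ := ↾(SmoothSimplex.pull φ.unop)
  map_id _ := ConcreteCategory.hom_ext _ _ fun σ ↦ SmoothSimplex.pull_id σ
  map_comp φ ψ := ConcreteCategory.hom_ext _ _ fun σ ↦
    SmoothSimplex.pull_comp φ.unop ψ.unop σ

/-- The functoriality of the simplicial set of smooth singular simplices. -/
def smoothSingFunctor : SmoothMan.{u} ⥤ SSet.{u} where
  obj := smoothSing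
  map f := { app n := ↾(SmoothSimplex.push f) }

/-- The complex of smooth singular chains: `C_n(M)` is the free abelian group on the smooth
singular `n`-simplices, and the differential is the alternating sum of the faces. -/
def smoothChains : SmoothMan.{u} ⥤ ChainComplex AddCommGrpCat.{u} ℕ :=
  smoothSingFunctor ⋙ (SimplicialObject.whiskering _ _).obj AddCommGrpCat.free ⋙
    AlgebraicTopology.alternatingFaceMapComplex AddCommGrpCat.{u}

/-- The dual complex `Hom(K, ℤ)` of a chain complex `K` of abelian groups. -/
def dualComplex (K : ChainComplex AddCommGrpCat.{u} ℕ) : CochainComplex AddCommGrpCat.{u} ℕ where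
  X n := AddCommGrpCat.of (K.X n →+ ℤ)
  d i j := AddCommGrpCat.ofHom (AddMonoidHom.compHom' (K.d j i).hom)
  shape i j h := by
    ext c
    have h0 : K.d j i = 0 := K.shape j i h
    simp [h0]
  d_comp_d' i j k _ _ := by
    ext c x
    have h0 : K.d k j ≫ K.d j i = 0 := K.d_comp_d k j i
    let c' : K.X i →+ ℤ := c
    change c' (K.d j i (K.d k j x)) = 0
    rw [← ConcreteCategory.comp_apply, h0]
    exact map_zero c'

/-- The transpose of a chain map. -/
def dualMap {K L : ChainComplex AddCommGrpCat.{u} ℕ} (f : K ⟶ L) :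
    dualComplex L ⟶ dualComplex K where
  f n := AddCommGrpCat.ofHom (AddMonoidHom.compHom' (f.f n).hom)
  comm' i j _ := by
    ext c
    refine AddMonoidHom.ext fun x ↦ ?_
    let c' : L.X i →+ ℤ := c
    change c' (f.f i (K.d j i x)) = c' (L.d j i (f.f j x))
    rw [← ConcreteCategory.comp_apply, ← ConcreteCategory.comp_apply, f.comm j i]

/-- The presheaf of complexes of smooth singular cochains with integer coefficients. -/
def smoothCochains : SmoothMan.{u}ᵒᵖ ⥤ CochainComplex AddCommGrpCat.{u} ℕ where
  obj M := dualComplex (smoothChains.obj M.unop)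
  map f := dualMap (smoothChains.map f.unop)
  map_id M := by
    rw [unop_id, smoothChains.map_id]
    rfl
  map_comp f g := by
    rw [unop_comp, smoothChains.map_comp]
    rfl

/-! ### The groupoid of 1-cocycles -/

/-- An object of the groupoid `ℋ¹(A)`: a 1-cocycle of the cochain complex `A`. -/
@[ext]
structure H1Obj (A : CochainComplex AddCommGrpCat.{u} ℕ) : Type u where
  z : A.X 1
  d_z : A.d 1 2 z = 0

/-- A morphism `x ⟶ y` of the groupoid `ℋ¹(A)`: a 0-cochain `b` with `d b = y - x`. As `A` is zero
in degree `-1`, no two distinct 0-cochains are identified. -/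
@[ext]
structure H1Hom {A : CochainComplex AddCommGrpCat.{u} ℕ} (x y : H1Obj A) : Type u where
  b : A.X 0
  d_b : A.d 0 1 b = y.z - x.z

/-- Composition is the addition of 0-cochains. -/
instance (A : CochainComplex AddCommGrpCat.{u} ℕ) : Groupoid (H1Obj A) where
  Hom x y := H1Hom x y
  id x := ⟨0, by simp⟩
  comp f g := ⟨f.b + g.b, by rw [map_add, f.d_b, g.d_b]; abel⟩
  inv f := ⟨-f.b, by rw [map_neg, f.d_b]; abel⟩
  id_comp f := H1Hom.ext (zero_add _)
  comp_id f := H1Hom.ext (add_zero _)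
  assoc f g h := H1Hom.ext (add_assoc _ _ _)
  inv_comp f := H1Hom.ext (neg_add_cancel _)
  comp_inv f := H1Hom.ext (add_neg_cancel _)

/-- The functor `ℋ¹` from cochain complexes to groupoids. -/
def H1 : CochainComplex AddCommGrpCat.{u} ℕ ⥤ Grpd.{u, u} where
  obj A := Grpd.of (H1Obj A)
  map {A B} f :=
    { obj := fun x ↦ (⟨f.f 1 x.z, by
        rw [← ConcreteCategory.comp_apply, f.comm 1 2, ConcreteCategory.comp_apply, x.d_z,
          map_zero]⟩ : H1Obj B)
      map := fun {x y} g ↦ (⟨f.f 0 g.b, by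
        rw [← ConcreteCategory.comp_apply, f.comm 0 1, ConcreteCategory.comp_apply, g.d_b,
          map_sub]⟩ : H1Hom _ _)
      map_id := fun _ ↦ H1Hom.ext (map_zero _)
      map_comp := fun _ _ ↦ H1Hom.ext (map_add _ _ _) }
  map_id _ := rfl
  map_comp _ _ := rfl

/-- The presheaf of groupoids `ℋ¹(C^•)` on manifolds. -/
def smoothH1 : SmoothMan.{u}ᵒᵖ ⥤ Grpd.{u, u} := smoothCochains ⋙ H1

/-- A presheaf of groupoids, as a pseudofunctor to categories. -/
def groupoidPseudofunctor {C : Type w} [Category.{v} C] (F : Cᵒᵖ ⥤ Grpd.{u, u}) :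
    Pseudofunctor (LocallyDiscrete Cᵒᵖ) Cat.{u, u} :=
  (F ⋙ Grpd.forgetToCat).toPseudofunctor'

end

/-! Cochains in positive degree do not glue, since a simplex of the base need not lie in one member
of a covering. What makes descent work is that 0-cochains and 1-cocycles do glue.

A 0-cochain is an arbitrary function on points, so it glues as soon as points lift. A 1-cocycle is
exactly additive under affine subdivision of a path, because affine triangles in the parameter
interval map to smooth 2-simplices; hence its values on short segments determine it. Conversely, let
`ζ` be a function on short paths that is a cocycle on small triangles. Along any simplex, the
Lebesgue number lemma makes `ζ` additive on triples of close parameters, and such a function is the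
difference of a potential (`exists_potential_of_locally_additive`, `exists_isPotential`). The
potential is unique up to a constant, so its difference at the end points of a path defines
`integral`. On a 2-simplex a single potential serves all three edges, so the integrals satisfy the
cocycle condition (`d_ofFun_integral`).

A covering family, in particular a surjective submersion, has local sections (`LocalSections`,
`exists_local_section`). Choosing one lift of every point of the base trivialises the gluing
cochains of a descent datum (`correction`); no continuity of the choice is needed. The cocycles so
corrected agree on overlaps, give a function on short paths of the base (`shortValue`), and its
integral is the glued cocycle. Full faithfulness follows from gluing 0-cochains and from
`eq_zero_of_map_eq_zero`. -/

noncomputable section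

/-! ### Smooth cochains as functions on smooth simplices -/

namespace SmoothCochain

/-- The value of a smooth singular cochain on a smooth simplex. -/
def eval {X : SmoothMan.{u}} {n : ℕ} (c : (smoothCochains.obj (op X)).X n)
    (σ : SmoothSimplex n X) : ℤ :=
  (show (smoothChains.obj X).X n →+ ℤ from c) (FreeAbelianGroup.of σ)

/-- The smooth singular cochain with given values on smooth simplices. -/
def ofFun {X : SmoothMan.{u}} {n : ℕ} (v : SmoothSimplex n X → ℤ) :
    (smoothCochains.obj (op X)).X n :=
  (FreeAbelianGroup.lift v : FreeAbelianGroup (SmoothSimplex n X) →+ ℤ)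

variable {X Y : SmoothMan.{u}} {n : ℕ}

@[simp] lemma eval_ofFun (v : SmoothSimplex n X → ℤ) (σ : SmoothSimplex n X) :
    eval (ofFun v) σ = v σ :=
  FreeAbelianGroup.lift_apply_of v σ

lemma ext {c c' : (smoothCochains.obj (op X)).X n} (h : ∀ σ, eval c σ = eval c' σ) : c = c' :=
  FreeAbelianGroup.lift_ext (show FreeAbelianGroup (SmoothSimplex n X) →+ ℤ from c)
    (show FreeAbelianGroup (SmoothSimplex n X) →+ ℤ from c') h

@[simp] lemma eval_zero (σ : SmoothSimplex n X) :
    eval (0 : (smoothCochains.obj (op X)).X n) σ = 0 := rfl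

@[simp] lemma eval_add (c c' : (smoothCochains.obj (op X)).X n) (σ : SmoothSimplex n X) :
    eval (c + c') σ = eval c σ + eval c' σ := rfl

@[simp] lemma eval_neg (c : (smoothCochains.obj (op X)).X n) (σ : SmoothSimplex n X) :
    eval (-c) σ = -eval c σ := rfl

@[simp] lemma eval_sub (c c' : (smoothCochains.obj (op X)).X n) (σ : SmoothSimplex n X) :
    eval (c - c') σ = eval c σ - eval c' σ := rfl

@[simp] lemma eval_pullback (f : X ⟶ Y) (c : (smoothCochains.obj (op Y)).X n)
    (σ : SmoothSimplex n X) :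
    eval (((smoothCochains.map f.op).f n) c) σ = eval c (SmoothSimplex.push f σ) := by
  change (show FreeAbelianGroup (SmoothSimplex n Y) →+ ℤ from c)
    (FreeAbelianGroup.map (SmoothSimplex.push f) (FreeAbelianGroup.of σ)) = _
  rw [FreeAbelianGroup.map_of_apply]
  rfl

lemma hom_sum_apply {ι : Type*} {A B : AddCommGrpCat.{u}} (s : Finset ι) (f : ι → (A ⟶ B))
    (x : A) : (∑ i ∈ s, f i).hom x = ∑ i ∈ s, (f i).hom x := by
  classical
  induction s using Finset.induction_on with
  | empty => rfl
  | insert i s hi ih => rw [Finset.sum_insert hi, Finset.sum_insert hi, ← ih]; rfl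

lemma eval_d (c : (smoothCochains.obj (op X)).X n) (σ : SmoothSimplex (n + 1) X) :
    eval ((smoothCochains.obj (op X)).d n (n + 1) c) σ =
      ∑ i : Fin (n + 2), (-1) ^ (i : ℕ) * eval c (SmoothSimplex.pull i.succAbove σ) := by
  change (show FreeAbelianGroup (SmoothSimplex n X) →+ ℤ from c)
    (((smoothChains.obj X).d (n + 1) n).hom (FreeAbelianGroup.of σ)) = _
  have h : (smoothChains.obj X).d (n + 1) n = ∑ i : Fin (n + 2), (-1 : ℤ) ^ (i : ℕ) •
      (((SimplicialObject.whiskering _ _).obj AddCommGrpCat.free).obj (smoothSing X)).δ i :=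
    AlgebraicTopology.AlternatingFaceMapComplex.obj_d_eq _ n
  rw [h]
  have h' : ∀ x, (∑ i : Fin (n + 2), (-1 : ℤ) ^ (i : ℕ) •
      (((SimplicialObject.whiskering _ _).obj AddCommGrpCat.free).obj (smoothSing X)).δ i).hom x
      = ∑ i : Fin (n + 2), (-1 : ℤ) ^ (i : ℕ) •
      ((((SimplicialObject.whiskering _ _).obj AddCommGrpCat.free).obj (smoothSing X)).δ i).hom x := by
    intro x
    simp only [hom_sum_apply, AddCommGrpCat.hom_zsmul, AddMonoidHom.smul_apply]
  erw [h', map_sum]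
  refine Finset.sum_congr rfl fun i _ ↦ ?_
  erw [map_zsmul, FreeAbelianGroup.map_of_apply]
  rfl

lemma eval_d_zero (c : (smoothCochains.obj (op X)).X 0) (σ : SmoothSimplex 1 X) :
    eval ((smoothCochains.obj (op X)).d 0 1 c) σ =
      eval c (SmoothSimplex.pull ![1] σ) - eval c (SmoothSimplex.pull ![0] σ) := by
  rw [eval_d, Fin.sum_univ_two]
  have h0 : (Fin.succAbove (0 : Fin 2)) = (![1] : Fin 1 → Fin 2) := by decide
  have h1 : (Fin.succAbove (1 : Fin 2)) = (![0] : Fin 1 → Fin 2) := by decide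
  rw [h0, h1]
  simp; ring

lemma eval_d_one (c : (smoothCochains.obj (op X)).X 1) (σ : SmoothSimplex 2 X) :
    eval ((smoothCochains.obj (op X)).d 1 2 c) σ =
      eval c (SmoothSimplex.pull ![1, 2] σ) - eval c (SmoothSimplex.pull ![0, 2] σ) +
        eval c (SmoothSimplex.pull ![0, 1] σ) := by
  rw [eval_d, Fin.sum_univ_three]
  have h0 : (Fin.succAbove (0 : Fin 3)) = (![1, 2] : Fin 2 → Fin 3) := by decide
  have h1 : (Fin.succAbove (1 : Fin 3)) = (![0, 2] : Fin 2 → Fin 3) := by decide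
  have h2 : (Fin.succAbove (2 : Fin 3)) = (![0, 1] : Fin 2 → Fin 3) := by decide
  rw [h0, h1, h2]
  simp; ring

end SmoothCochain

/-! ### Affine reparametrisation of smooth simplices -/

/-- The affine map of standard simplices with prescribed values on the vertices. -/
def stdSimplex.affineMap {n m : ℕ} (P : Fin (m + 1) → stdSimplex ℝ (Fin (n + 1)))
    (x : stdSimplex ℝ (Fin (m + 1))) : stdSimplex ℝ (Fin (n + 1)) :=
  ⟨∑ i, x i • (P i : Fin (n + 1) → ℝ), (convex_stdSimplex ℝ _).sum_mem
    (fun i _ ↦ x.2.1 i) x.2.2 (fun i _ ↦ (P i).2)⟩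

namespace stdSimplex

variable {n m k : ℕ}

lemma affineMap_coe (P : Fin (m + 1) → stdSimplex ℝ (Fin (n + 1)))
    (x : stdSimplex ℝ (Fin (m + 1))) :
    (affineMap P x : Fin (n + 1) → ℝ) = ∑ i, x i • (P i : Fin (n + 1) → ℝ) := rfl

lemma affineMap_affineMap (P : Fin (m + 1) → stdSimplex ℝ (Fin (n + 1)))
    (Q : Fin (k + 1) → stdSimplex ℝ (Fin (m + 1))) (x : stdSimplex ℝ (Fin (k + 1))) :
    affineMap P (affineMap Q x) = affineMap (fun i ↦ affineMap P (Q i)) x := by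
  apply stdSimplex.ext
  simp only [affineMap_coe, Finset.smul_sum]
  rw [Finset.sum_comm]
  refine Finset.sum_congr rfl fun i _ ↦ ?_
  change (affineMap Q x : Fin (m + 1) → ℝ) i • _ = _
  simp [affineMap_coe, Finset.sum_smul, mul_smul]

lemma affineMap_vertex (P : Fin (m + 1) → stdSimplex ℝ (Fin (n + 1))) (i : Fin (m + 1)) :
    affineMap P (vertex i) = P i := by
  apply stdSimplex.ext
  rw [affineMap_coe]
  have : ∀ j, (vertex i : stdSimplex ℝ (Fin (m + 1))) j = (Pi.single i 1 : Fin (m + 1) → ℝ) j :=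
    fun j ↦ congrFun (vertex_coe i) j
  simp [this, Pi.single_apply]

lemma map_eq_affineMap (φ : Fin (m + 1) → Fin (n + 1)) (x : stdSimplex ℝ (Fin (m + 1))) :
    map φ x = affineMap (fun i ↦ vertex (φ i)) x := by
  apply stdSimplex.ext
  rw [affineMap_coe, map_coe]
  ext j
  simp [FunOnFinite.linearMap_apply_apply, Pi.single_apply, Finset.sum_ite, eq_comm]

lemma affineMap_vertices (x : stdSimplex ℝ (Fin (m + 1))) :
    affineMap (fun i ↦ vertex i) x = x := by
  rw [← map_eq_affineMap (fun i ↦ i)]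
  exact map_id_apply x

/-- An affine simplex with vertices close to a point stays close to it. -/
lemma dist_affineMap_lt {P : Fin (m + 1) → stdSimplex ℝ (Fin (n + 1))}
    {p : stdSimplex ℝ (Fin (n + 1))} {δ : ℝ} (h : ∀ i, dist (P i) p < δ)
    (x : stdSimplex ℝ (Fin (m + 1))) : dist (affineMap P x) p < δ :=
  (convex_ball (p : Fin (n + 1) → ℝ) δ).sum_mem (fun i _ ↦ x.2.1 i) x.2.2 (fun i _ ↦ h i)

lemma continuous_affineMap (P : Fin (m + 1) → stdSimplex ℝ (Fin (n + 1))) :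
    Continuous (affineMap P) := by
  refine Continuous.subtype_mk (continuous_finsetSum _ fun i _ ↦ ?_) _
  exact ((continuous_apply i).comp continuous_subtype_val).smul continuous_const

end stdSimplex

namespace SmoothSimplex

variable {n m k : ℕ} {M N : SmoothMan.{u}}

/-- Precomposition of a smooth simplex with an affine map of standard simplices. -/
def affinePull (P : Fin (m + 1) → stdSimplex ℝ (Fin (n + 1))) (σ : SmoothSimplex n M) :
    SmoothSimplex m M where
  toFun x := σ.toFun (stdSimplex.affineMap P x)
  exists_extension := by
    obtain ⟨V, g, hV, hsub, hg, hext⟩ := σ.exists_extension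
    let L : (Fin (m + 1) → ℝ) →L[ℝ] (Fin (n + 1) → ℝ) :=
      ∑ i, (ContinuousLinearMap.proj (R := ℝ) i).smulRight (P i : Fin (n + 1) → ℝ)
    have hL (x : stdSimplex ℝ (Fin (m + 1))) : L x = stdSimplex.affineMap P x := by
      simp [L, stdSimplex.affineMap_coe]
    refine ⟨L ⁻¹' V, g ∘ L, hV.preimage L.continuous, fun x hx ↦ ?_, ?_, fun x ↦ ?_⟩
    · exact hsub (hL ⟨x, hx⟩ ▸ (stdSimplex.affineMap P ⟨x, hx⟩).2)
    · exact hg.comp L.contMDiff.contMDiffOn (fun x hx ↦ hx)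
    · rw [Function.comp_apply, hL]
      exact hext _

lemma pull_affinePull (φ : Fin (k + 1) → Fin (m + 1))
    (P : Fin (m + 1) → stdSimplex ℝ (Fin (n + 1))) (σ : SmoothSimplex n M) :
    pull φ (affinePull P σ) = affinePull (P ∘ φ) σ := by
  refine SmoothSimplex.ext (funext fun x ↦ congrArg σ.toFun ?_)
  rw [stdSimplex.map_eq_affineMap, stdSimplex.affineMap_affineMap]
  simp only [stdSimplex.affineMap_vertex]
  rfl

lemma pull_eq_affinePull (φ : Fin (m + 1) → Fin (n + 1)) (σ : SmoothSimplex n M) :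
    pull φ σ = affinePull (fun i ↦ stdSimplex.vertex (φ i)) σ :=
  SmoothSimplex.ext (funext fun x ↦ congrArg σ.toFun (stdSimplex.map_eq_affineMap φ x))

lemma affinePull_affinePull (P : Fin (m + 1) → stdSimplex ℝ (Fin (n + 1)))
    (Q : Fin (k + 1) → stdSimplex ℝ (Fin (m + 1))) (σ : SmoothSimplex n M) :
    affinePull Q (affinePull P σ) = affinePull (fun i ↦ stdSimplex.affineMap P (Q i)) σ :=
  SmoothSimplex.ext (funext fun x ↦ congrArg σ.toFun (stdSimplex.affineMap_affineMap P Q x))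

lemma affinePull_vertices (σ : SmoothSimplex n M) :
    affinePull (fun i ↦ stdSimplex.vertex i) σ = σ :=
  SmoothSimplex.ext (funext fun x ↦ congrArg σ.toFun (stdSimplex.affineMap_vertices x))

lemma push_pull (f : M ⟶ N) (φ : Fin (m + 1) → Fin (n + 1))
    (σ : SmoothSimplex n M) : push f (pull φ σ) = pull φ (push f σ) := rfl

lemma push_comp {P : SmoothMan.{u}} (f : M ⟶ N) (g : N ⟶ P) (σ : SmoothSimplex n M) :
    push (f ≫ g) σ = push g (push f σ) := rfl

lemma continuous_toFun (σ : SmoothSimplex n M) : Continuous σ.toFun := by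
  obtain ⟨V, g, hV, hsub, hg, hext⟩ := σ.exists_extension
  have : σ.toFun = g ∘ Subtype.val := funext fun x ↦ (hext x).symm
  rw [this]
  exact hg.continuousOn.comp_continuous continuous_subtype_val fun x ↦ hsub x.2

end SmoothSimplex

/-! ### Potentials of locally additive functions -/

section Midpoint

variable {T A : Type*} [PseudoMetricSpace T] [AddCommGroup A] {mid : T → T → T}

/-- On a bounded space with midpoints, a function of pairs of close points that is additive on
close triples is the difference of a function of one variable. -/
theorem exists_potential_of_locally_additive (hsymm : ∀ p q, mid p q = mid q p)
    (hmid : ∀ p q, dist p (mid p q) ≤ dist p q / 2)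
    (hmid' : ∀ p q r, dist (mid p q) (mid p r) ≤ dist q r / 2) (n : ℕ) :
    ∀ (δ : ℝ), 0 < δ → (∀ p q : T, dist p q < 2 ^ n * δ) → ∀ ℓ : T → T → A,
      (∀ p q r, dist p q < δ → dist q r < δ → dist p r < δ → ℓ p q + ℓ q r = ℓ p r) →
      ∃ h : T → A, ∀ p q, dist p q < δ → ℓ p q = h q - h p := by
  induction n with
  | zero =>
    intro δ _ hd ℓ hℓ
    -- At this scale all pairs are close, so the values from a base point form a potential.
    simp only [pow_zero, one_mul] at hd
    rcases isEmpty_or_nonempty T with _ | ⟨⟨o⟩⟩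
    · exact ⟨fun _ ↦ 0, fun p ↦ isEmptyElim p⟩
    · exact ⟨ℓ o, fun p q _ ↦ eq_sub_of_add_eq' (hℓ o p q (hd _ _) (hd _ _) (hd _ _))⟩
  | succ n ih =>
    intro δ hδ hd ℓ hℓ
    have hself (p : T) : ℓ p p = 0 := by
      have := hℓ p p p (by simpa) (by simpa) (by simpa)
      simpa using this
    have hneg (p q : T) (hpq : dist p q < δ) : ℓ q p = -ℓ p q := by
      have := hℓ p q p hpq (by rwa [dist_comm]) (by simpa)
      rw [hself] at this
      exact eq_neg_of_add_eq_zero_right this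
    have hmid₂ (p q : T) : dist (mid p q) q ≤ dist p q / 2 := by
      rw [hsymm, dist_comm, dist_comm p]
      exact hmid q p
    -- Double the scale: between points at distance less than `2 * δ`, pass through the midpoint.
    obtain ⟨h, hh⟩ := ih (2 * δ) (by positivity)
      (fun p q ↦ (hd p q).trans_eq (by ring)) (fun p q ↦ ℓ p (mid p q) + ℓ (mid p q) q) (by
        intro p q r hpq hqr hpr
        have a1 := hmid p q
        have a2 := hmid₂ p q
        have b1 := hmid q r
        have b2 := hmid₂ q r
        have c1 := hmid p r
        have c2 := hmid₂ p r
        have e1 := hmid' p q r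
        have e2 := hmid' q p r
        have e3 := hmid' r p q
        rw [hsymm q p] at e2
        rw [hsymm r p, hsymm r q] at e3
        -- The midpoints cut the triangle `p q r` into three corner triangles and a middle one, all
        -- with sides shorter than `δ`; their four relations add up to additivity on `p q r`.
        have t1 := hℓ p (mid p q) (mid p r) (by linarith) (by linarith) (by linarith)
        have t2 := hℓ (mid p q) q (mid q r) (by linarith) (by linarith) (by linarith)
        have t3 := hℓ (mid p r) (mid q r) r (by linarith) (by linarith) (by linarith)
        have t4 := hℓ (mid p q) (mid q r) (mid p r) (by linarith)
          (by rw [dist_comm]; linarith) (by linarith)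
        have t5 := hneg (mid p r) (mid q r) (by linarith)
        rw [t5] at t4
        rw [← t3, ← t1, ← t4, ← t2]
        abel)
    refine ⟨h, fun p q hpq ↦ ?_⟩
    have a1 := hmid p q
    have a2 := hmid₂ p q
    have : 0 ≤ dist p q := dist_nonneg
    rw [← hh p q (by linarith)]
    exact (hℓ _ _ _ (by linarith) (by linarith) hpq).symm

end Midpoint

namespace stdSimplex

variable {n m : ℕ}

/-- The midpoint of two points of the standard simplex. -/
def mid (p q : stdSimplex ℝ (Fin (n + 1))) : stdSimplex ℝ (Fin (n + 1)) :=
  ⟨midpoint ℝ (p : Fin (n + 1) → ℝ) q, (convex_stdSimplex ℝ _).midpoint_mem p.2 q.2⟩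

lemma mid_comm (p q : stdSimplex ℝ (Fin (n + 1))) : mid p q = mid q p :=
  stdSimplex.ext (midpoint_comm _ _)

lemma dist_mid (p q : stdSimplex ℝ (Fin (n + 1))) : dist p (mid p q) ≤ dist p q / 2 := by
  refine (dist_left_midpoint (𝕜 := ℝ) (p : Fin (n + 1) → ℝ) q).le.trans_eq ?_
  rw [Real.norm_ofNat, inv_mul_eq_div]
  rfl

lemma dist_mid_mid (p q r : stdSimplex ℝ (Fin (n + 1))) :
    dist (mid p q) (mid p r) ≤ dist q r / 2 := by
  refine (dist_midpoint_midpoint_le (p : Fin (n + 1) → ℝ) q p r).trans_eq ?_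
  rw [dist_self, zero_add]
  rfl

instance : PreconnectedSpace (stdSimplex ℝ (Fin (n + 1))) :=
  Subtype.preconnectedSpace (convex_stdSimplex ℝ _).isPreconnected

lemma exists_potential {A : Type*} [AddCommGroup A] {δ : ℝ} (hδ : 0 < δ)
    (ℓ : stdSimplex ℝ (Fin (n + 1)) → stdSimplex ℝ (Fin (n + 1)) → A)
    (hℓ : ∀ p q r, dist p q < δ → dist q r < δ → dist p r < δ → ℓ p q + ℓ q r = ℓ p r) :
    ∃ h : stdSimplex ℝ (Fin (n + 1)) → A, ∀ p q, dist p q < δ → ℓ p q = h q - h p := by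
  -- The simplex has diameter at most 1, so any `k` with `2 ^ k * δ > 1` will do.
  obtain ⟨k, hk⟩ := pow_unbounded_of_one_lt (1 / δ) one_lt_two
  refine exists_potential_of_locally_additive mid_comm dist_mid dist_mid_mid k δ hδ
    (fun p q ↦ ?_) ℓ hℓ
  rw [div_lt_iff₀ hδ] at hk
  refine lt_of_le_of_lt ?_ hk
  exact (Metric.dist_le_diam_of_mem (bounded_stdSimplex _) p.2 q.2).trans diam_stdSimplex_le

lemma eq_of_locally_eq {A : Type*} {δ : ℝ} (hδ : 0 < δ) {h : stdSimplex ℝ (Fin (n + 1)) → A}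
    (hh : ∀ p q, dist p q < δ → h p = h q) (p q : stdSimplex ℝ (Fin (n + 1))) : h p = h q := by
  refine IsLocallyConstant.apply_eq_of_preconnectedSpace ?_ p q
  rw [IsLocallyConstant.iff_eventually_eq]
  intro x
  filter_upwards [Metric.ball_mem_nhds x hδ] with y hy using hh y x hy

end stdSimplex

/-! ### Potentials along simplices and the integral along a path -/

namespace SmoothSimplex

open SmoothCochain

variable {n m : ℕ} {M N : SmoothMan.{u}} {ι : Type*}

/-- A smooth simplex is subordinate to a family of open subsets if it lies in one of them. -/
def Subordinate (U : ι → TopologicalSpace.Opens M) (σ : SmoothSimplex n M) : Prop :=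
  ∃ i, ∀ x, σ.toFun x ∈ U i

/-- A function on the simplex is a potential of `ζ` along `σ` if its differences over short
segments are the values of `ζ` on the images of these segments. -/
def IsPotential (ζ : SmoothSimplex 1 M → ℤ) (σ : SmoothSimplex n M)
    (h : stdSimplex ℝ (Fin (n + 1)) → ℤ) : Prop :=
  ∃ δ > 0, ∀ p q, dist p q < δ → ζ (affinePull ![p, q] σ) = h q - h p

/-- The difference of two potentials is locally constant, and the simplex is connected. -/
lemma IsPotential.sub_eq_sub {ζ : SmoothSimplex 1 M → ℤ} {σ : SmoothSimplex n M}
    {h h' : stdSimplex ℝ (Fin (n + 1)) → ℤ} (H : IsPotential ζ σ h) (H' : IsPotential ζ σ h')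
    (p q : stdSimplex ℝ (Fin (n + 1))) : h q - h p = h' q - h' p := by
  obtain ⟨δ, hδ, H⟩ := H
  obtain ⟨δ', hδ', H'⟩ := H'
  have := stdSimplex.eq_of_locally_eq (lt_min hδ hδ') (h := fun x ↦ h x - h' x) (fun x y hxy ↦ by
    have h1 := H x y (hxy.trans_le (min_le_left _ _))
    have h2 := H' x y (hxy.trans_le (min_le_right _ _))
    linarith) p q
  linarith

/-- A Lebesgue number of the preimage covering works: balls are convex, so an affine simplex with
vertices in a ball stays in it. -/
lemma exists_subordinate_affinePull {U : ι → TopologicalSpace.Opens M} (hU : ∀ x, ∃ i, x ∈ U i)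
    (σ : SmoothSimplex n M) : ∃ δ > 0, ∀ (m : ℕ) (P : Fin (m + 1) → stdSimplex ℝ (Fin (n + 1))),
      (∀ i, dist (P i) (P 0) < δ) → (affinePull P σ).Subordinate U := by
  obtain ⟨δ, hδ, H⟩ := lebesgue_number_lemma_of_metric (s := Set.univ)
    (c := fun i ↦ σ.toFun ⁻¹' (U i)) isCompact_univ
    (fun i ↦ (U i).isOpen.preimage σ.continuous_toFun)
    (fun x _ ↦ Set.mem_iUnion.2 (hU (σ.toFun x)))
  refine ⟨δ, hδ, fun m P hP ↦ ?_⟩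
  obtain ⟨i, hi⟩ := H (P 0) trivial
  exact ⟨i, fun x ↦ hi (stdSimplex.dist_affineMap_lt hP x)⟩

/-- Being a potential only tests short segments, and these are subordinate to the covering. -/
lemma IsPotential.congr {U : ι → TopologicalSpace.Opens M} (hU : ∀ x, ∃ i, x ∈ U i)
    {ζ ζ' : SmoothSimplex 1 M → ℤ} {σ : SmoothSimplex n M} {h : stdSimplex ℝ (Fin (n + 1)) → ℤ}
    (hζ : ∀ p q, (affinePull ![p, q] σ).Subordinate U →
      ζ (affinePull ![p, q] σ) = ζ' (affinePull ![p, q] σ))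
    (H : IsPotential ζ σ h) : IsPotential ζ' σ h := by
  obtain ⟨δ, hδ, H⟩ := H
  obtain ⟨δ', hδ', H'⟩ := exists_subordinate_affinePull hU σ
  refine ⟨min δ δ', lt_min hδ hδ', fun p q hpq ↦ ?_⟩
  rw [← H p q (hpq.trans_le (min_le_left _ _)), hζ]
  refine H' 1 _ (Fin.forall_fin_two.2 ⟨by simpa using hδ', ?_⟩)
  rw [dist_comm]
  exact hpq.trans_le (min_le_right _ _)

lemma IsPotential.affinePull {ζ : SmoothSimplex 1 M → ℤ} {σ : SmoothSimplex n M}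
    {h : stdSimplex ℝ (Fin (n + 1)) → ℤ} (H : IsPotential ζ σ h)
    (P : Fin (m + 1) → stdSimplex ℝ (Fin (n + 1))) :
    IsPotential ζ (affinePull P σ) (h ∘ stdSimplex.affineMap P) := by
  obtain ⟨δ, hδ, H⟩ := H
  obtain ⟨δ', hδ', H'⟩ := Metric.uniformContinuous_iff.1
    (CompactSpace.uniformContinuous_of_continuous (stdSimplex.continuous_affineMap P)) δ hδ
  refine ⟨δ', hδ', fun p q hpq ↦ ?_⟩
  rw [affinePull_affinePull]
  rw [Function.comp_apply, Function.comp_apply, ← H _ _ (H' hpq)]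
  congr 2
  ext i : 1
  fin_cases i <;> rfl

lemma exists_isPotential {U : ι → TopologicalSpace.Opens M} (hU : ∀ x, ∃ i, x ∈ U i)
    {ζ : SmoothSimplex 1 M → ℤ}
    (hζ : ∀ τ : SmoothSimplex 2 M, τ.Subordinate U →
      ζ (pull ![1, 2] τ) - ζ (pull ![0, 2] τ) + ζ (pull ![0, 1] τ) = 0)
    (σ : SmoothSimplex n M) : ∃ h, IsPotential ζ σ h := by
  obtain ⟨δ, hδ, H⟩ := exists_subordinate_affinePull hU σ
  -- Close parameters `p`, `q`, `r` span an affine triangle with subordinate image; `hζ` on it is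
  -- the additivity required.
  obtain ⟨h, hh⟩ := stdSimplex.exists_potential hδ (fun p q ↦ ζ (SmoothSimplex.affinePull ![p, q] σ))
    (fun p q r hpq hqr hpr ↦ by
      have := hζ (SmoothSimplex.affinePull ![p, q, r] σ) (H 2 _ (fun i ↦ by
        fin_cases i
        · simpa using hδ
        · rw [dist_comm]; exact hpq
        · rw [dist_comm]; exact hpr))
      simp only [pull_affinePull] at this
      have e1 : ![p, q, r] ∘ ![1, 2] = ![q, r] := by ext i : 1; fin_cases i <;> rfl
      have e2 : ![p, q, r] ∘ ![0, 2] = ![p, r] := by ext i : 1; fin_cases i <;> rfl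
      have e3 : ![p, q, r] ∘ ![0, 1] = ![p, q] := by ext i : 1; fin_cases i <;> rfl
      rw [e1, e2, e3] at this
      linarith)
  exact ⟨h, δ, hδ, hh⟩

open Classical in
/-- The integral along a path of a function defined on short paths: the difference of the values
of a potential at the end points. -/
def integral (ζ : SmoothSimplex 1 M → ℤ) (γ : SmoothSimplex 1 M) : ℤ :=
  if H : ∃ h, IsPotential ζ γ h then
    H.choose (stdSimplex.vertex 1) - H.choose (stdSimplex.vertex 0) else 0

lemma IsPotential.integral_eq {ζ : SmoothSimplex 1 M → ℤ} {γ : SmoothSimplex 1 M}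
    {h : stdSimplex ℝ (Fin 2) → ℤ} (H : IsPotential ζ γ h) :
    integral ζ γ = h (stdSimplex.vertex 1) - h (stdSimplex.vertex 0) := by
  have H' : ∃ h, IsPotential ζ γ h := ⟨h, H⟩
  rw [integral, dif_pos H']
  exact H'.choose_spec.sub_eq_sub H _ _

/-- One potential on the whole simplex computes the integrals along all its edges, so that sums
around a boundary telescope. -/
lemma IsPotential.integral_pull {ζ : SmoothSimplex 1 M → ℤ} {σ : SmoothSimplex n M}
    {h : stdSimplex ℝ (Fin (n + 1)) → ℤ} (H : IsPotential ζ σ h) (φ : Fin 2 → Fin (n + 1)) :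
    integral ζ (pull φ σ) = h (stdSimplex.vertex (φ 1)) - h (stdSimplex.vertex (φ 0)) := by
  rw [pull_eq_affinePull, (H.affinePull _).integral_eq]
  simp only [Function.comp_apply, stdSimplex.affineMap_vertex]

/-- The cochain of integrals of a function that is a cocycle on subordinate triangles is a
cocycle. -/
lemma d_ofFun_integral {U : ι → TopologicalSpace.Opens M} (hU : ∀ x, ∃ i, x ∈ U i)
    {ζ : SmoothSimplex 1 M → ℤ}
    (hζ : ∀ τ : SmoothSimplex 2 M, τ.Subordinate U →
      ζ (pull ![1, 2] τ) - ζ (pull ![0, 2] τ) + ζ (pull ![0, 1] τ) = 0) :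
    (smoothCochains.obj (op M)).d 1 2 (ofFun (integral ζ)) = 0 := by
  refine SmoothCochain.ext fun τ ↦ ?_
  obtain ⟨h, H⟩ := exists_isPotential hU hζ τ
  rw [eval_d_one, eval_ofFun, eval_ofFun, eval_ofFun, H.integral_pull, H.integral_pull,
    H.integral_pull]
  simp

/-- For a genuine cocycle, additivity holds on all triples, so its values on the segments from a
fixed vertex form a potential with no restriction on distances; the bound 1 below is arbitrary. -/
lemma integral_eval {c : (smoothCochains.obj (op M)).X 1}
    (hc : (smoothCochains.obj (op M)).d 1 2 c = 0) (γ : SmoothSimplex 1 M) :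
    (∃ h, IsPotential (eval c) γ h) ∧ integral (eval c) γ = eval c γ := by
  have hadd (p q r : stdSimplex ℝ (Fin 2)) : eval c (SmoothSimplex.affinePull ![p, q] γ) +
      eval c (SmoothSimplex.affinePull ![q, r] γ) =
      eval c (SmoothSimplex.affinePull ![p, r] γ) := by
    have := eval_d_one c (SmoothSimplex.affinePull ![p, q, r] γ)
    simp only [hc, pull_affinePull] at this
    have e1 : ![p, q, r] ∘ ![1, 2] = ![q, r] := by ext i : 1; fin_cases i <;> rfl
    have e2 : ![p, q, r] ∘ ![0, 2] = ![p, r] := by ext i : 1; fin_cases i <;> rfl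
    have e3 : ![p, q, r] ∘ ![0, 1] = ![p, q] := by ext i : 1; fin_cases i <;> rfl
    rw [e1, e2, e3, eval_zero] at this
    linarith
  let o : stdSimplex ℝ (Fin 2) := stdSimplex.vertex 0
  have H : IsPotential (eval c) γ (fun p ↦ eval c (SmoothSimplex.affinePull ![o, p] γ)) :=
    ⟨1, one_pos, fun p q _ ↦ by linarith [hadd o p q]⟩
  refine ⟨⟨_, H⟩, ?_⟩
  rw [H.integral_eq]
  -- The cocycle vanishes on the constant path.
  have h1 := hadd o o o
  have h2 : (![o, stdSimplex.vertex 1] : Fin 2 → stdSimplex ℝ (Fin 2)) =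
      fun i ↦ stdSimplex.vertex i := by
    ext i : 1; fin_cases i <;> rfl
  rw [h2, affinePull_vertices]
  change eval c γ - eval c (SmoothSimplex.affinePull ![o, o] γ) = _
  linarith

/-- If a function on short paths agrees with a cocycle on subordinate paths of a manifold over
`M`, then so do the integrals along all paths. -/
lemma integral_push {U : ι → TopologicalSpace.Opens M} (hU : ∀ x, ∃ i, x ∈ U i)
    {ζ : SmoothSimplex 1 M → ℤ} (f : N ⟶ M) {c : (smoothCochains.obj (op N)).X 1}
    (hc : (smoothCochains.obj (op N)).d 1 2 c = 0)
    (hζ : ∀ γ : SmoothSimplex 1 N, (push f γ).Subordinate U → ζ (push f γ) = eval c γ)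
    (γ : SmoothSimplex 1 N) : integral ζ (push f γ) = eval c γ := by
  obtain ⟨⟨h, H⟩, H'⟩ := integral_eval hc γ
  let V : ι → TopologicalSpace.Opens N :=
    fun i ↦ (U i).comap ⟨f.toFun, SmoothMan.continuous_toFun f⟩
  have : IsPotential (fun γ' ↦ ζ (push f γ')) γ h :=
    H.congr (U := V) (fun x ↦ hU (f.toFun x)) (fun p q hpq ↦ (hζ _ hpq).symm)
  replace this : IsPotential ζ (push f γ) h := this
  rw [this.integral_eq, ← H', H.integral_eq]

end SmoothSimplex

/-! ### The pseudofunctor of groupoids of cocycles -/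

namespace SmoothH1

open SmoothCochain

variable {X Y Z : SmoothMan.{u}}

/-- The cocycle underlying an object. -/
def cocycle (x : (groupoidPseudofunctor smoothH1.{u}).obj (.mk (op X))) :
    (smoothCochains.obj (op X)).X 1 :=
  H1Obj.z (A := smoothCochains.obj (op X)) x

/-- The object given by a cocycle. -/
def mk (z : (smoothCochains.obj (op X)).X 1) (hz : (smoothCochains.obj (op X)).d 1 2 z = 0) :
    (groupoidPseudofunctor smoothH1.{u}).obj (.mk (op X)) :=
  (⟨z, hz⟩ : H1Obj (smoothCochains.obj (op X)))

/-- The cochain underlying a morphism. -/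
def cochain {x y : (groupoidPseudofunctor smoothH1.{u}).obj (.mk (op X))} (φ : x ⟶ y) :
    (smoothCochains.obj (op X)).X 0 :=
  H1Hom.b (A := smoothCochains.obj (op X)) φ

/-- The morphism given by a cochain. -/
def homMk {x y : (groupoidPseudofunctor smoothH1.{u}).obj (.mk (op X))}
    (b : (smoothCochains.obj (op X)).X 0)
    (hb : (smoothCochains.obj (op X)).d 0 1 b = cocycle y - cocycle x) : x ⟶ y :=
  (⟨b, hb⟩ : H1Hom (A := smoothCochains.obj (op X)) x y)

lemma d_cocycle (x : (groupoidPseudofunctor smoothH1.{u}).obj (.mk (op X))) :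
    (smoothCochains.obj (op X)).d 1 2 (cocycle x) = 0 :=
  H1Obj.d_z (A := smoothCochains.obj (op X)) x

section

variable {x y z : (groupoidPseudofunctor smoothH1.{u}).obj (.mk (op X))}

@[simp] lemma cochain_homMk (b : (smoothCochains.obj (op X)).X 0)
    (hb : (smoothCochains.obj (op X)).d 0 1 b = cocycle y - cocycle x) :
    cochain (homMk b hb : x ⟶ y) = b := rfl

lemma d_cochain (φ : x ⟶ y) :
    (smoothCochains.obj (op X)).d 0 1 (cochain φ) = cocycle y - cocycle x :=
  H1Hom.d_b (A := smoothCochains.obj (op X)) φ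

lemma hom_ext {φ ψ : x ⟶ y} (h : cochain φ = cochain ψ) : φ = ψ :=
  H1Hom.ext (A := smoothCochains.obj (op X)) h

@[simp] lemma cochain_id : cochain (𝟙 x) = 0 := rfl

@[simp] lemma cochain_comp (φ : x ⟶ y) (ψ : y ⟶ z) :
    cochain (φ ≫ ψ) = cochain φ + cochain ψ := rfl

/-- The isomorphism given by a cochain. -/
def isoMk (b : (smoothCochains.obj (op X)).X 0)
    (hb : (smoothCochains.obj (op X)).d 0 1 b = cocycle y - cocycle x) : x ≅ y where
  hom := homMk b hb
  inv := homMk (-b) (by rw [map_neg, hb, neg_sub])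
  hom_inv_id := hom_ext (by simp)
  inv_hom_id := hom_ext (by simp)

@[simp] lemma cochain_isoMk_hom (b : (smoothCochains.obj (op X)).X 0)
    (hb : (smoothCochains.obj (op X)).d 0 1 b = cocycle y - cocycle x) :
    cochain (isoMk b hb : x ≅ y).hom = b := rfl

end

@[simp] lemma cocycle_map (f : X ⟶ Y)
    (y : (groupoidPseudofunctor smoothH1.{u}).obj (.mk (op Y))) :
    cocycle (((groupoidPseudofunctor smoothH1.{u}).map f.op.toLoc).toFunctor.obj y) =
      (smoothCochains.map f.op).f 1 (cocycle y) := rfl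

@[simp] lemma cochain_map (f : X ⟶ Y)
    {y z : (groupoidPseudofunctor smoothH1.{u}).obj (.mk (op Y))} (φ : y ⟶ z) :
    cochain (((groupoidPseudofunctor smoothH1.{u}).map f.op.toLoc).toFunctor.map φ) =
      (smoothCochains.map f.op).f 0 (cochain φ) := rfl

/-- The presheaf is strict, so the coherence isomorphisms of its pseudofunctor come from equalities
and contribute nothing to cochains. -/
lemma cochain_eqToIso_hom_app {A : Cat.{u, u}}
    {F G : A ⟶ (groupoidPseudofunctor smoothH1.{u}).obj (.mk (op X))} (h : F = G) (x : A) :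
    cochain ((eqToIso h).hom.toNatTrans.app x) = 0 := by
  subst h
  rfl

lemma cochain_eqToIso_inv_app {A : Cat.{u, u}}
    {F G : A ⟶ (groupoidPseudofunctor smoothH1.{u}).obj (.mk (op X))} (h : F = G) (x : A) :
    cochain ((eqToIso h).inv.toNatTrans.app x) = 0 := by
  subst h
  rfl

@[simp] lemma cochain_mapComp'_hom (f : Y ⟶ X) (g : Z ⟶ Y) (k : Z ⟶ X)
    (h : f.op.toLoc ≫ g.op.toLoc = k.op.toLoc)
    (x : (groupoidPseudofunctor smoothH1.{u}).obj (.mk (op X))) :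
    cochain (((groupoidPseudofunctor smoothH1.{u}).mapComp' f.op.toLoc g.op.toLoc k.op.toLoc
      h).hom.toNatTrans.app x) = 0 := by
  obtain rfl : g ≫ f = k := congrArg (fun t ↦ t.as.unop) h
  change cochain (((groupoidPseudofunctor smoothH1.{u}).mapComp' f.op.toLoc g.op.toLoc
    (f.op.toLoc ≫ g.op.toLoc) rfl).hom.toNatTrans.app x) = 0
  rw [Pseudofunctor.mapComp'_eq_mapComp]
  exact cochain_eqToIso_hom_app _ x

@[simp] lemma cochain_mapComp'_inv (f : Y ⟶ X) (g : Z ⟶ Y) (k : Z ⟶ X)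
    (h : f.op.toLoc ≫ g.op.toLoc = k.op.toLoc)
    (x : (groupoidPseudofunctor smoothH1.{u}).obj (.mk (op X))) :
    cochain (((groupoidPseudofunctor smoothH1.{u}).mapComp' f.op.toLoc g.op.toLoc k.op.toLoc
      h).inv.toNatTrans.app x) = 0 := by
  obtain rfl : g ≫ f = k := congrArg (fun t ↦ t.as.unop) h
  change cochain (((groupoidPseudofunctor smoothH1.{u}).mapComp' f.op.toLoc g.op.toLoc
    (f.op.toLoc ≫ g.op.toLoc) rfl).inv.toNatTrans.app x) = 0
  rw [Pseudofunctor.mapComp'_eq_mapComp]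
  exact cochain_eqToIso_inv_app _ x

lemma cochain_pullHom ⦃X₁ X₂ : SmoothMan.{u}⦄
    ⦃M₁ : (groupoidPseudofunctor smoothH1.{u}).obj (.mk (op X₁))⦄
    ⦃M₂ : (groupoidPseudofunctor smoothH1.{u}).obj (.mk (op X₂))⦄
    ⦃Y : SmoothMan.{u}⦄ ⦃f₁ : Y ⟶ X₁⦄ ⦃f₂ : Y ⟶ X₂⦄
    (φ : ((groupoidPseudofunctor smoothH1.{u}).map f₁.op.toLoc).toFunctor.obj M₁ ⟶
      ((groupoidPseudofunctor smoothH1.{u}).map f₂.op.toLoc).toFunctor.obj M₂)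
    ⦃Y' : SmoothMan.{u}⦄ (g : Y' ⟶ Y) (gf₁ : Y' ⟶ X₁) (gf₂ : Y' ⟶ X₂)
    (hgf₁ : g ≫ f₁ = gf₁) (hgf₂ : g ≫ f₂ = gf₂) :
    cochain (Pseudofunctor.LocallyDiscreteOpToCat.pullHom φ g gf₁ gf₂ hgf₁ hgf₂) =
      (smoothCochains.map g.op).f 0 (cochain φ) := by
  rw [Pseudofunctor.LocallyDiscreteOpToCat.pullHom, cochain_comp, cochain_comp,
    cochain_mapComp'_hom, cochain_mapComp'_inv, cochain_map, zero_add, add_zero]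

end SmoothH1

/-! ### Points, restrictions to open subsets, and local sections of submersions -/

namespace SmoothMan

/-- The manifold with a single point. -/
def point : SmoothMan.{u} :=
  let e : OpenPartialHomeomorph PUnit.{u + 1} (EuclideanSpace ℝ (Fin 0)) :=
    (Homeomorph.homeomorphOfUnique PUnit.{u + 1} (EuclideanSpace ℝ (Fin 0))).toOpenPartialHomeomorph
  letI : ChartedSpace (EuclideanSpace ℝ (Fin 0)) PUnit.{u + 1} := e.singletonChartedSpace rfl
  haveI : IsManifold (𝓡 0) ∞ PUnit.{u + 1} :=
    { e.singleton_hasGroupoid rfl (contDiffGroupoid ∞ (𝓡 0)) with }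
  { carrier := PUnit.{u + 1}
    dim := 0 }

instance : Unique point.{u} where
  default := PUnit.unit
  uniq _ := rfl

variable {X Y : SmoothMan.{u}}

/-- The inclusion of a point into a manifold. -/
def const (x : X) : point.{u} ⟶ X where
  toFun _ := x
  contMDiff := contMDiff_const

lemma point_hom_ext {a b : point.{u} ⟶ X} (h : a.toFun default = b.toFun default) : a = b :=
  SmoothMan.hom_ext (funext fun p ↦ by rwa [Subsingleton.elim p default])

/-- The preimage of an open subset under a smooth map. -/
def preimage (f : X ⟶ Y) (U : TopologicalSpace.Opens Y) : TopologicalSpace.Opens X :=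
  U.comap ⟨f.toFun, continuous_toFun f⟩

/-- A submersion admits local sections through the images of points. -/
lemma exists_local_section (π : X ⟶ Y)
    (hπ : Manifold.IsSubmersion (𝓡 X.dim) (𝓡 Y.dim) ∞ π.toFun) (x : X) :
    ∃ (U : TopologicalSpace.Opens Y) (s : Y.ofOpen U ⟶ X),
      π.toFun x ∈ U ∧ s ≫ π = Y.incl U := by
  obtain ⟨F, _, _, hF⟩ := hπ
  have h := hF x
  set φ := h.domChart.extend (𝓡 X.dim) with hφ
  set ψ := h.codChart.extend (𝓡 Y.dim) with hψ
  have hxφ : x ∈ φ.source := by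
    rw [hφ, OpenPartialHomeomorph.extend_source]
    exact h.mem_domChart_source
  -- In adapted charts the submersion is a projection; the section keeps the fibre coordinate equal
  -- to that of `x`.
  let c : F := (h.equiv (φ x)).2
  let v : Y → EuclideanSpace ℝ (Fin X.dim) := fun y ↦ h.equiv.symm (ψ y, c)
  have hψsmooth : ContMDiffOn (𝓡 Y.dim) 𝓘(ℝ, EuclideanSpace ℝ (Fin Y.dim)) ∞ ψ
      h.codChart.source :=
    OpenPartialHomeomorph.contMDiffOn_extend h.codChart_mem_maximalAtlas
  have hv : ContMDiffOn (𝓡 Y.dim) 𝓘(ℝ, EuclideanSpace ℝ (Fin X.dim)) ∞ v h.codChart.source := by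
    have hlin : ContDiff ℝ ∞ fun w : EuclideanSpace ℝ (Fin Y.dim) ↦ h.equiv.symm (w, c) :=
      h.equiv.symm.contDiff.comp (contDiff_id.prodMk contDiff_const)
    exact hlin.contMDiff.comp_contMDiffOn hψsmooth
  have hφt : IsOpen φ.target := h.domChart.isOpen_extend_target
  let U : TopologicalSpace.Opens Y := ⟨h.codChart.source ∩ v ⁻¹' φ.target,
    hv.continuousOn.isOpen_inter_preimage h.codChart.open_source hφt⟩
  have hs : ContMDiffOn (𝓡 Y.dim) (𝓡 X.dim) ∞ (φ.symm ∘ v) U := by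
    have h1 : ContMDiffOn 𝓘(ℝ, EuclideanSpace ℝ (Fin X.dim)) (𝓡 X.dim) ∞ φ.symm φ.target := by
      have := contMDiffOn_extend_symm h.domChart_mem_maximalAtlas
      rwa [← OpenPartialHomeomorph.extend_target'] at this
    exact h1.comp (hv.mono Set.inter_subset_left) Set.inter_subset_right
  refine ⟨U, ⟨fun y ↦ φ.symm (v y.1), ?_⟩, ⟨?_, ?_⟩, ?_⟩
  · exact hs.comp_contMDiff (Y.incl U).contMDiff fun y ↦ y.2
  · exact h.mem_codChart_source
  · have h1 := h.writtenInCharts (φ.map_source hxφ)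
    rw [Function.comp_apply, Function.comp_apply, φ.left_inv hxφ] at h1
    have h2 : v (π.toFun x) = φ x := by
      change h.equiv.symm (ψ (π.toFun x), (h.equiv (φ x)).2) = φ x
      rw [h1]
      exact h.equiv.symm_apply_apply _
    rw [Set.mem_preimage, h2]
    exact φ.map_source hxφ
  · refine SmoothMan.hom_ext (funext fun y ↦ ?_)
    obtain ⟨y, hy⟩ := y
    change π.toFun (φ.symm (v y)) = y
    have h1 := h.writtenInCharts hy.2
    have h2 : φ.symm (v y) ∈ h.domChart.source := by
      rw [← OpenPartialHomeomorph.extend_source (I := 𝓡 X.dim)]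
      exact φ.map_target hy.2
    have h3 := h.mapsto_domChart_source_codChart_source h2
    rw [Function.comp_apply, Function.comp_apply, Function.comp_apply,
      h.equiv.apply_symm_apply] at h1
    refine ψ.injOn ?_ ?_ h1
    · rwa [hψ, OpenPartialHomeomorph.extend_source]
    · rw [hψ, OpenPartialHomeomorph.extend_source]
      exact hy.1

/-- A surjective submersion is a covering for the topology of open coverings. -/
lemma ofArrows_mem_openTopology_of_isSubmersion (π : X ⟶ Y)
    (hπ : Manifold.IsSubmersion (𝓡 X.dim) (𝓡 Y.dim) ∞ π.toFun)
    (hsurj : Function.Surjective π.toFun) :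
    Sieve.ofArrows (fun _ : PUnit.{1} ↦ X) (fun _ ↦ π) ∈ openTopology Y := by
  intro y
  obtain ⟨x, rfl⟩ := hsurj y
  obtain ⟨U, s, hxU, hs⟩ := exists_local_section π hπ x
  exact ⟨U, hxU, _, s, _, Presieve.ofArrows.mk PUnit.unit, hs⟩

/-- A family of open subsets with union the whole manifold is a covering. -/
lemma ofArrows_incl_mem_openTopology {ι : Type*} (U : ι → TopologicalSpace.Opens X)
    (hU : ∀ x : X, ∃ i, x ∈ U i) :
    Sieve.ofArrows (fun i ↦ X.ofOpen (U i)) (fun i ↦ X.incl (U i)) ∈ openTopology X := by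
  intro x
  obtain ⟨i, hi⟩ := hU x
  exact ⟨U i, hi, Sieve.ofArrows_mk _ _ i⟩

end SmoothMan

namespace SmoothSimplex

open SmoothMan

variable {n : ℕ} {M N : SmoothMan.{u}}

/-- A smooth simplex with values in an open subset, as a simplex of this open subset. -/
def corestrict (σ : SmoothSimplex n M) (U : TopologicalSpace.Opens M)
    (h : ∀ x, σ.toFun x ∈ U) : SmoothSimplex n (M.ofOpen U) where
  toFun x := ⟨σ.toFun x, h x⟩
  exists_extension := by
    classical
    obtain ⟨V, g, hV, hsub, hg, hext⟩ := σ.exists_extension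
    -- The extension `g` may leave `U` away from the simplex. The value `o` taken there is
    -- irrelevant, as the neighbourhood is shrunk to the part that `g` maps into `U`.
    let o : U := ⟨σ.toFun (stdSimplex.vertex 0), h _⟩
    let g' : (Fin (n + 1) → ℝ) → U := fun x ↦ if hx : g x ∈ U then ⟨g x, hx⟩ else o
    have hg' {x} (hx : g x ∈ U) : (g' x : M) = g x := by simp only [g', dif_pos hx]
    refine ⟨V ∩ g ⁻¹' U, g', hg.continuousOn.isOpen_inter_preimage hV U.isOpen,
      fun x hx ↦ ⟨hsub hx, ?_⟩, fun x hx ↦ ?_, fun x ↦ ?_⟩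
    · change g x ∈ U
      exact (hext ⟨x, hx⟩) ▸ h _
    · refine (ContMDiffWithinAt.subtypeVal_comp_iff (I' := 𝓡 M.dim) U g' _ x).1 ?_
      exact (hg.mono Set.inter_subset_left x hx).congr (fun y hy ↦ hg' hy.2) (hg' hx.2)
    · have hx : g x ∈ U := by
        rw [hext]
        exact h x
      exact Subtype.ext ((hg' hx).trans (hext x))

lemma push_incl_corestrict (σ : SmoothSimplex n M) (U : TopologicalSpace.Opens M)
    (h : ∀ x, σ.toFun x ∈ U) : push (M.incl U) (σ.corestrict U h) = σ := rfl

/-- The `0`-simplex of the point. -/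
def pointSimplex : SmoothSimplex 0 point.{u} where
  toFun _ := default
  exists_extension := ⟨Set.univ, fun _ ↦ default, isOpen_univ, Set.subset_univ _,
    contMDiffOn_const, fun _ ↦ rfl⟩

/-- The point underlying a `0`-simplex. -/
def toPoint (σ : SmoothSimplex 0 M) : point.{u} ⟶ M := const (σ.toFun default)

@[simp] lemma push_toPoint (σ : SmoothSimplex 0 M) : push (toPoint σ) pointSimplex = σ :=
  SmoothSimplex.ext (funext fun _ ↦ congrArg σ.toFun (Subsingleton.elim _ _))

@[simp] lemma toPoint_push (f : M ⟶ N) (σ : SmoothSimplex 0 M) :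
    toPoint (push f σ) = toPoint σ ≫ f := rfl

end SmoothSimplex

/-! ### Descent of cocycles -/

/-- The gluing morphisms of a global object are composites of coherence isomorphisms, which every
additive `c` as above kills. -/
lemma map_toDescentData_hom_eq_zero {C : Type*} [Category* C]
    (F : Pseudofunctor (LocallyDiscrete Cᵒᵖ) Cat) {A : C → Type*} [∀ Y, AddMonoid (A Y)]
    (c : ∀ {Y : C} {a b : F.obj (.mk (op Y))}, (a ⟶ b) → A Y)
    (hcomp : ∀ {Y : C} {x y z : F.obj (.mk (op Y))} (φ : x ⟶ y) (ψ : y ⟶ z),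
      c (φ ≫ ψ) = c φ + c ψ)
    (hhom : ∀ {X Y Z : C} (f : Y ⟶ X) (g : Z ⟶ Y) (k : Z ⟶ X)
      (h : f.op.toLoc ≫ g.op.toLoc = k.op.toLoc) (x : F.obj (.mk (op X))),
      c ((F.mapComp' f.op.toLoc g.op.toLoc k.op.toLoc h).hom.toNatTrans.app x) = 0)
    (hinv : ∀ {X Y Z : C} (f : Y ⟶ X) (g : Z ⟶ Y) (k : Z ⟶ X)
      (h : f.op.toLoc ≫ g.op.toLoc = k.op.toLoc) (x : F.obj (.mk (op X))),
      c ((F.mapComp' f.op.toLoc g.op.toLoc k.op.toLoc h).inv.toNatTrans.app x) = 0)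
    {ι : Type*} {S : C} {X : ι → C} {f : ∀ i, X i ⟶ S} (x : F.obj (.mk (op S))) {Y : C}
    (q : Y ⟶ S) {i j : ι} (f₁ : Y ⟶ X i) (f₂ : Y ⟶ X j)
    (h₁ : f₁ ≫ f i = q) (h₂ : f₂ ≫ f j = q) :
    c (((F.toDescentData f).obj x).hom q f₁ f₂ h₁ h₂) = 0 :=
  (hcomp _ _).trans ((congrArg₂ (· + ·) (hinv (f i) f₁ q (by rw [← h₁]; rfl) x)
    (hhom (f j) f₂ q (by rw [← h₂]; rfl) x)).trans (add_zero _))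

namespace SmoothH1

open SmoothCochain SmoothMan SmoothSimplex

/-- A family of smooth maps with local sections over an open covering. -/
structure LocalSections {ι : Type w} {S : SmoothMan.{u}} {X : ι → SmoothMan.{u}}
    (f : ∀ i, X i ⟶ S) where
  opens (x : S) : TopologicalSpace.Opens S
  mem_opens (x : S) : x ∈ opens x
  index (x : S) : ι
  sec (x : S) : S.ofOpen (opens x) ⟶ X (index x)
  sec_comp (x : S) : sec x ≫ f (index x) = S.incl (opens x)

variable {ι : Type w} {S : SmoothMan.{u}} {X : ι → SmoothMan.{u}} {f : ∀ i, X i ⟶ S}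

lemma nonempty_localSections (hf : Sieve.ofArrows X f ∈ openTopology S) :
    Nonempty (LocalSections f) := by
  have h (x : S) : ∃ (U : TopologicalSpace.Opens S) (i : ι) (s : S.ofOpen U ⟶ X i),
      x ∈ U ∧ s ≫ f i = S.incl U := by
    obtain ⟨U, hxU, _, s, _, ⟨i⟩, hs⟩ := hf x
    exact ⟨U, i, s, hxU, hs⟩
  choose U i s hx hs using h
  exact ⟨⟨U, hx, i, s, hs⟩⟩

namespace LocalSections

variable (L : LocalSections f)

/-- The index of the chosen lift of a point. -/
def pointIndex (t : point.{u} ⟶ S) : ι := L.index (t.toFun default)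

/-- The chosen lift of a point. -/
def pointLift (t : point.{u} ⟶ S) : point.{u} ⟶ X (L.pointIndex t) :=
  const ((L.sec (t.toFun default)).toFun ⟨t.toFun default, L.mem_opens _⟩)

@[simp] lemma pointLift_comp (t : point.{u} ⟶ S) :
    L.pointLift t ≫ f (L.pointIndex t) = t :=
  point_hom_ext (congrFun (congrArg SmoothMan.Hom.toFun (L.sec_comp (t.toFun default)))
    ⟨t.toFun default, L.mem_opens _⟩)

lemma exists_mem (x : S) : ∃ y, x ∈ L.opens y := ⟨x, L.mem_opens x⟩

/-- The lift of a simplex of the base that lies in one of the chosen open subsets. -/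
def liftSimplex {n : ℕ} (y : S) (σ : SmoothSimplex n S) (h : ∀ x, σ.toFun x ∈ L.opens y) :
    SmoothSimplex n (X (L.index y)) :=
  push (L.sec y) (σ.corestrict (L.opens y) h)

@[simp] lemma push_liftSimplex {n : ℕ} (y : S) (σ : SmoothSimplex n S)
    (h : ∀ x, σ.toFun x ∈ L.opens y) : push (f (L.index y)) (L.liftSimplex y σ h) = σ := by
  rw [liftSimplex, ← push_comp, L.sec_comp, push_incl_corestrict]

end LocalSections

/-- A cocycle that vanishes on the paths that lift is zero. -/
lemma eq_zero_of_map_eq_zero (L : LocalSections f) {c : (smoothCochains.obj (op S)).X 1}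
    (hc : (smoothCochains.obj (op S)).d 1 2 c = 0)
    (h : ∀ i, (smoothCochains.map (f i).op).f 1 c = 0) : c = 0 := by
  refine SmoothCochain.ext fun γ ↦ ?_
  rw [← (integral_eval hc γ).2]
  -- Compare with the zero cocycle: short paths lift, so `c` vanishes on them.
  refine integral_push (U := L.opens) L.exists_mem (𝟙 S) (c := 0) (map_zero _) ?_ γ
  rintro γ' ⟨y, hy⟩
  change eval c γ' = 0
  conv_lhs => rw [← L.push_liftSimplex y γ' hy]
  rw [← eval_pullback, h, eval_zero]


/-! ### Full faithfulness: gluing of 0-cochains -/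

section FullyFaithful

lemma cochain_toDescentData_hom (x : (groupoidPseudofunctor smoothH1.{u}).obj (.mk (op S)))
    {Y : SmoothMan.{u}} (q : Y ⟶ S) {i j : ι} (f₁ : Y ⟶ X i) (f₂ : Y ⟶ X j)
    (h₁ : f₁ ≫ f i = q) (h₂ : f₂ ≫ f j = q) :
    cochain ((((groupoidPseudofunctor smoothH1.{u}).toDescentData f).obj x).hom
      q f₁ f₂ h₁ h₂) = 0 :=
  map_toDescentData_hom_eq_zero (groupoidPseudofunctor smoothH1.{u})
    (A := fun Y ↦ (smoothCochains.obj (op Y)).X 0) (fun φ ↦ cochain φ) cochain_comp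
    cochain_mapComp'_hom cochain_mapComp'_inv x q f₁ f₂ h₁ h₂

lemma faithful (L : LocalSections f) :
    ((groupoidPseudofunctor smoothH1.{u}).toDescentData f).Faithful where
  map_injective {x y φ ψ} h := by
    refine hom_ext (SmoothCochain.ext fun σ ↦ ?_)
    have h' (i : ι) : (smoothCochains.map (f i).op).f 0 (cochain φ) =
        (smoothCochains.map (f i).op).f 0 (cochain ψ) :=
      congrArg (fun t ↦ cochain (Pseudofunctor.DescentData.Hom.hom t i)) h
    have h'' := congrArg (fun t ↦ eval t (push (L.pointLift (toPoint σ)) pointSimplex))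
      (h' (L.pointIndex (toPoint σ)))
    simpa only [eval_pullback, ← push_comp, L.pointLift_comp, push_toPoint] using h''

/-- The components of a morphism of descent data agree at points with the same image, so they
descend to a function on points of the base. Its coboundary is the right one because the discrepancy
is a cocycle that pulls back to zero on every `X i`. -/
lemma full (L : LocalSections f) :
    ((groupoidPseudofunctor smoothH1.{u}).toDescentData f).Full where
  map_surjective {x y} φ := by
    have comm (i j : ι) (a : point.{u} ⟶ X i) (b : point.{u} ⟶ X j) (h : a ≫ f i = b ≫ f j) :
        eval (cochain (φ.hom i)) (push a pointSimplex) =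
          eval (cochain (φ.hom j)) (push b pointSimplex) := by
      have := congrArg (fun t ↦ eval (cochain t) pointSimplex) (φ.comm _ a b h rfl)
      rwa [cochain_comp, cochain_comp, eval_add, eval_add, cochain_toDescentData_hom,
        cochain_toDescentData_hom, eval_zero, add_zero, zero_add, cochain_map, cochain_map,
        eval_pullback, eval_pullback] at this
    let b : (smoothCochains.obj (op S)).X 0 := ofFun fun σ ↦
      eval (cochain (φ.hom (L.pointIndex (toPoint σ))))
        (push (L.pointLift (toPoint σ)) pointSimplex)
    have hb (i : ι) : (smoothCochains.map (f i).op).f 0 b = cochain (φ.hom i) := by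
      refine SmoothCochain.ext fun σ ↦ ?_
      rw [eval_pullback, eval_ofFun]
      conv_rhs => rw [← push_toPoint σ]
      exact comm _ _ _ _ (by simp)
    have hd : (smoothCochains.obj (op S)).d 0 1 b = cocycle y - cocycle x := by
      rw [← sub_eq_zero]
      refine eq_zero_of_map_eq_zero L ?_ fun i ↦ ?_
      · rw [map_sub, map_sub, d_cocycle, d_cocycle, ← ConcreteCategory.comp_apply,
          HomologicalComplex.d_comp_d]
        simp
      · have h1 := d_cochain (φ.hom i)
        rw [← hb i, ← ConcreteCategory.comp_apply, (smoothCochains.map (f i).op).comm 0 1,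
          ConcreteCategory.comp_apply] at h1
        rw [map_sub, h1, map_sub]
        exact sub_self _
    refine ⟨homMk b hd, ?_⟩
    ext i
    exact hom_ext (hb i)

end FullyFaithful

/-! ### Essential surjectivity: gluing of 1-cocycles -/

section EssSurj

variable (L : LocalSections f) (D : (groupoidPseudofunctor smoothH1.{u}).DescentData f)

/-- The value of the gluing cochains of a descent datum at a pair of points over the same point. -/
def gluing {i j : ι} (a : point.{u} ⟶ X i) (b : point.{u} ⟶ X j) (h : a ≫ f i = b ≫ f j) : ℤ :=
  eval (cochain (D.hom (b ≫ f j) a b h rfl)) pointSimplex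

lemma gluing_add {i j k : ι} (a : point.{u} ⟶ X i) (b : point.{u} ⟶ X j) (c : point.{u} ⟶ X k)
    (h : a ≫ f i = b ≫ f j) (h' : b ≫ f j = c ≫ f k) :
    gluing D a b h + gluing D b c h' = gluing D a c (h.trans h') := by
  have := congrArg (fun t ↦ eval (cochain t) pointSimplex)
    (D.hom_comp (c ≫ f k) a b c (h.trans h') h' rfl)
  simp only [cochain_comp, eval_add] at this
  rw [gluing, gluing, gluing, ← this]
  congr!

/-- Compatibility of the gluing with pull-back to a point: its value depends only on the two images
of that point, so `gluing` records the whole gluing datum. -/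
lemma eval_hom {Y : SmoothMan.{u}} (q : Y ⟶ S) {i j : ι} (f₁ : Y ⟶ X i) (f₂ : Y ⟶ X j)
    (h₁ : f₁ ≫ f i = q) (h₂ : f₂ ≫ f j = q) (σ : SmoothSimplex 0 Y) :
    eval (cochain (D.hom q f₁ f₂ h₁ h₂)) σ = gluing D (toPoint σ ≫ f₁) (toPoint σ ≫ f₂)
      (by rw [Category.assoc, Category.assoc, h₁, h₂]) := by
  rw [gluing, ← D.pullHom_hom (toPoint σ) q _ (by rw [Category.assoc, h₂]) f₁ f₂ h₁ h₂ _ _ rfl rfl,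
    cochain_pullHom, eval_pullback, push_toPoint]

/-- The cochain on `X i` given by the gluing with the chosen lifts of points. -/
def correction (i : ι) : (smoothCochains.obj (op (X i))).X 0 :=
  ofFun fun σ ↦ gluing D (toPoint σ) (L.pointLift (toPoint σ ≫ f i)) (L.pointLift_comp _).symm

/-- Both corrections compare with the same chosen lift, so the gluing function is a difference of
corrections. -/
lemma gluing_add_correction {i j : ι} (σ : SmoothSimplex 0 (X i)) (τ : SmoothSimplex 0 (X j))
    (h : toPoint σ ≫ f i = toPoint τ ≫ f j) :
    gluing D (toPoint σ) (toPoint τ) h + eval (correction L D j) τ =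
      eval (correction L D i) σ := by
  rw [correction, correction, eval_ofFun, eval_ofFun, gluing_add]
  congr! 1 <;> rw [h]

/-- The cocycles of a descent datum, corrected so as to agree on overlaps. -/
def corrected (i : ι) : (smoothCochains.obj (op (X i))).X 1 :=
  cocycle (D.obj i) + (smoothCochains.obj (op (X i))).d 0 1 (correction L D i)

lemma d_corrected (i : ι) :
    (smoothCochains.obj (op (X i))).d 1 2 (corrected L D i) = 0 := by
  rw [corrected, map_add, d_cocycle, ← ConcreteCategory.comp_apply, HomologicalComplex.d_comp_d]
  simp

/-- The coboundary of the gluing cochain is the difference of the two cocycles, and the corrections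
cancel it. -/
lemma eval_corrected {Y : SmoothMan.{u}} (q : Y ⟶ S) {i j : ι} (f₁ : Y ⟶ X i) (f₂ : Y ⟶ X j)
    (h₁ : f₁ ≫ f i = q) (h₂ : f₂ ≫ f j = q) (γ : SmoothSimplex 1 Y) :
    eval (corrected L D j) (push f₂ γ) = eval (corrected L D i) (push f₁ γ) := by
  have h := congrArg (fun t ↦ eval t γ) (d_cochain (D.hom q f₁ f₂ h₁ h₂))
  simp only [eval_sub, cocycle_map, eval_pullback, eval_d_zero, eval_hom] at h
  have h0 (σ : SmoothSimplex 0 Y) := gluing_add_correction L D (push f₁ σ) (push f₂ σ)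
    (by rw [toPoint_push, toPoint_push, Category.assoc, Category.assoc, h₁, h₂])
  simp only [toPoint_push] at h0
  rw [corrected, corrected, eval_add, eval_add, eval_d_zero, eval_d_zero]
  simp only [← push_pull]
  linarith [h0 (pull ![0] γ), h0 (pull ![1] γ)]

open Classical in
/-- The common value of the corrected cocycles on short paths of the base. -/
def shortValue (γ : SmoothSimplex 1 S) : ℤ :=
  if h : γ.Subordinate L.opens then
    eval (corrected L D (L.index h.choose)) (L.liftSimplex h.choose γ h.choose_spec) else 0

lemma shortValue_push (i : ι) (γ : SmoothSimplex 1 (X i))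
    (h : (push (f i) γ).Subordinate L.opens) :
    shortValue L D (push (f i) γ) = eval (corrected L D i) γ := by
  rw [shortValue, dif_pos h]
  -- On `V` there are two maps over `S`: the inclusion into `X i`, and `f i` followed by the chosen
  -- section. The corrected cocycles agree along them.
  let V := SmoothMan.preimage (f i) (L.opens h.choose)
  exact eval_corrected L D ((X i).incl V ≫ f i) ((X i).incl V)
    (SmoothMan.lift ((X i).incl V ≫ f i) (L.opens h.choose) (fun y ↦ y.2) ≫ L.sec h.choose) rfl
    (by rw [Category.assoc, L.sec_comp]; rfl) (γ.corestrict V h.choose_spec)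

lemma shortValue_cocycle (τ : SmoothSimplex 2 S) (h : τ.Subordinate L.opens) :
    shortValue L D (pull ![1, 2] τ) - shortValue L D (pull ![0, 2] τ) +
      shortValue L D (pull ![0, 1] τ) = 0 := by
  obtain ⟨y, hy⟩ := h
  have key (φ : Fin 2 → Fin 3) : shortValue L D (pull φ τ) =
      eval (corrected L D (L.index y)) (pull φ (L.liftSimplex y τ hy)) := by
    rw [← shortValue_push, push_pull, L.push_liftSimplex]
    rw [push_pull, L.push_liftSimplex]
    exact ⟨y, fun x ↦ hy _⟩
  rw [key, key, key, ← eval_d_one, d_corrected, eval_zero]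

/-- The cocycle on the base glued from a descent datum. -/
def glued : (smoothCochains.obj (op S)).X 1 := ofFun (integral (shortValue L D))

lemma d_glued : (smoothCochains.obj (op S)).d 1 2 (glued L D) = 0 :=
  d_ofFun_integral (U := L.opens) L.exists_mem (shortValue_cocycle L D)

lemma map_glued (i : ι) :
    (smoothCochains.map (f i).op).f 1 (glued L D) = corrected L D i := by
  refine SmoothCochain.ext fun γ ↦ ?_
  rw [eval_pullback, glued, eval_ofFun]
  exact integral_push (U := L.opens) L.exists_mem (f i) (d_corrected L D i)
    (shortValue_push L D i) γ

/-- The descent datum of the glued cocycle is isomorphic to the given one. -/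
def gluedIso : ((groupoidPseudofunctor smoothH1.{u}).toDescentData f).obj
    (mk (glued L D) (d_glued L D)) ≅ D :=
  Pseudofunctor.DescentData.isoMk
    (fun i ↦ isoMk (-correction L D i) (by
      change _ = cocycle (D.obj i) - (smoothCochains.map (f i).op).f 1 (glued L D)
      rw [map_glued, corrected, map_neg]
      abel))
    (fun Y q i j f₁ f₂ h₁ h₂ ↦ by
      refine hom_ext (SmoothCochain.ext fun σ ↦ ?_)
      have h0 := gluing_add_correction L D (push f₁ σ) (push f₂ σ)
        (by rw [toPoint_push, toPoint_push, Category.assoc, Category.assoc, h₁, h₂])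
      simp only [toPoint_push] at h0
      rw [cochain_comp, cochain_comp, eval_add, eval_add, cochain_map, cochain_map, eval_pullback,
        eval_pullback, eval_hom, cochain_isoMk_hom, cochain_isoMk_hom,
        cochain_toDescentData_hom, eval_neg, eval_neg, eval_zero]
      linarith)

end EssSurj

/-- Descent for cocycles along a family of smooth maps with local sections. -/
lemma isEquivalence_toDescentData (hf : Sieve.ofArrows X f ∈ openTopology S) :
    ((groupoidPseudofunctor smoothH1.{u}).toDescentData f).IsEquivalence := by
  obtain ⟨L⟩ := nonempty_localSections hf
  have := faithful L
  have := full L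
  have : ((groupoidPseudofunctor smoothH1.{u}).toDescentData f).EssSurj :=
    ⟨fun D ↦ ⟨_, ⟨gluedIso L D⟩⟩⟩
  exact { }

end SmoothH1

end

theorem mainTheorem7 :
    (groupoidPseudofunctor smoothH1.{u}).IsStack SmoothMan.openTopology.{u} ∧
    (∀ (M : SmoothMan.{u}) (ι : Type v) (U : ι → TopologicalSpace.Opens M),
      (∀ x : M, ∃ i, x ∈ U i) →
      ((groupoidPseudofunctor smoothH1.{u}).toDescentData
        (fun i ↦ M.incl (U i))).IsEquivalence) ∧
    (∀ (U M : SmoothMan.{u}) (π : U ⟶ M),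
      Manifold.IsSubmersion (𝓡 U.dim) (𝓡 M.dim) ∞ π.toFun → Function.Surjective π.toFun →
      ((groupoidPseudofunctor smoothH1.{u}).toDescentData
        (fun _ : PUnit.{1} ↦ π)).IsEquivalence) := by
  refine ⟨Pseudofunctor.IsStack.of_isStackFor fun S R hR ↦ ⟨?_⟩, fun M ι U hU ↦ ?_,
    fun U M π hπ hsurj ↦ ?_⟩
  -- The family of all arrows in `R` generates `R` itself.
  · exact SmoothH1.isEquivalence_toDescentData
      (by rwa [Sieve.ofArrows_category', Sieve.generate_sieve])
  · exact SmoothH1.isEquivalence_toDescentData (SmoothMan.ofArrows_incl_mem_openTopology U hU)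
  · exact SmoothH1.isEquivalence_toDescentData
      (SmoothMan.ofArrows_mem_openTopology_of_isSubmersion π hπ hsurj)
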